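/- **Corollary 3.5 (Van Kampen for bound quivers).** Let $k$ be a field, let $Q$ be a finite quiver, and let $I$ be an admissible two-sided ideal of the path algebra $kQ$, that is, $F^m\subseteq I\subseteq F^2$ for some $m\ge 2$, where $F$ is the two-sided ideal generated by the arrows. A path $w$ is *non-zero* if $w\notin I$. A *minimal relation* is an element $\sum_{i=1}^m\lambda_i w_i\in I$ with $m\ge 2$, $\lambda_i\in k\setminus\{0\}$, and $w_1,\dots,w_m$ distinct paths with common source and common target, such that $\sum_{i\in J}\lambda_i w_i\notin I$ for every non-empty proper subset $J\subset\{1,\dots,m\}$. The *homotopy relation* $\sim$ on walks (paths in the arrows and their formal inverses, composed from left to right) is the smallest equivalence relation such that $\alpha\alpha^{-1}\sim e_x$ and $\alpha^{-1}\alpha\sim e_y$ for every arrow $\alpha\colon x\to y$, such that $w_i\sim w_j$ whenever $w_i,w_j$ appear in the same minimal relation, and such that $u\sim v$ implies $wuw'\sim wvw'$ whenever these compositions are defined. For a vertex $x_0$, let $\pi_1(Q,x_0)$ be the fundamental group of the underlying graph of $Q$ at $x_0$, and let $$\pi_1(Q,I,x_0)=\pi_1(Q,x_0)/N(Q,I,x_0),$$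 where $N(Q,I,x_0)$ is the normal subgroup generated by the classes of all $w\,u\,v^{-1}w^{-1}$ with $w$ a walk from $x_0$ to $x$ and $u\sim v$ homotopic paths from $x$ to $y$. (If $Q$ is connected, this group does not depend on $x_0$ up to isomorphism and is denoted $\pi_1(Q,I)$.) Let $Q^1$ and $Q^2$ be full subquivers of $Q$ that are convex (every path of $Q$ between two vertices of $Q^i$ lies entirely in $Q^i$). Suppose that every non-zero path of $Q$ lies entirely in $Q^1$ or entirely in $Q^2$, and that $Q^0=Q^1\cap Q^2$ is connected (in particular non-empty). For $i=0,1,2$ put $I^i=I\cap kQ^i$. Then, for every vertex $x_0$ of $Q^0$, the square of groups $$\begin{array}{ccc}\pi_1(Q^0,I^0,x_0)&\longrightarrow&\pi_1(Q^1,I^1,x_0)\\ \downarrow&&\downarrow\\ \pi_1(Q^2,I^2,x_0)&\longrightarrow&\pi_1(Q,I,x_0)\end{array}$$ whose arrows are the maps induced by the inclusions, is commutative and is a pushout square. -/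

import Mathlib

namespace BoundQuiver

open Quiver CategoryTheory

universe w u v u' v'

/-! ### The path algebra -/

section PathAlgebra

/-- The set of all paths of a quiver, including one stationary path for each vertex. -/
abbrev AllPaths (V : Type u) [Quiver.{v} V] : Type (max u v) := Σ x y : V, Path x y

/-- The path algebra `kQ`: the `k`-vector space with basis all the paths of the quiver. -/
def PathAlgebra (k : Type w) [Field k] (V : Type u) [Quiver.{v} V] : Type (max w u v) :=
  AllPaths V →₀ k

variable (k : Type w) [Field k] {V : Type u} [Quiver.{v} V]

noncomputable instance : AddCommGroup (PathAlgebra k V) :=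
  inferInstanceAs (AddCommGroup (AllPaths V →₀ k))

noncomputable instance : Module k (PathAlgebra k V) :=
  inferInstanceAs (Module k (AllPaths V →₀ k))

/-- The basis element of `kQ` given by a path. -/
noncomputable def ofPath {x y : V} (p : Path x y) : PathAlgebra k V :=
  Finsupp.single (⟨x, y, p⟩ : AllPaths V) (1 : k)

/-- The linear extension to `kQ` of a map defined on paths. -/
noncomputable def extend {M : Type*} [AddCommGroup M] [Module k M]
    (f : ∀ x y : V, Path x y → M) : PathAlgebra k V →ₗ[k] M :=
  Finsupp.linearCombination k (fun p : AllPaths V => f p.1 p.2.1 p.2.2)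

variable {k}

@[simp] theorem extend_ofPath {M : Type*} [AddCommGroup M] [Module k M]
    (f : ∀ x y : V, Path x y → M) {x y : V} (p : Path x y) :
    extend k f (ofPath k p) = f x y p := by
  simp only [extend, ofPath]
  erw [Finsupp.linearCombination_single, one_smul]

theorem linearMap_ext {M : Type*} [AddCommGroup M] [Module k M]
    {f g : PathAlgebra k V →ₗ[k] M}
    (h : ∀ (x y : V) (p : Path x y), f (ofPath k p) = g (ofPath k p)) : f = g := by
  apply Finsupp.lhom_ext'
  rintro ⟨x, y, p⟩
  apply LinearMap.ext_ring
  exact h x y p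

variable (k)

open Classical in
/-- The product of two paths: their composition (`p` first, then `q`) whenever the target of `p`
is the source of `q`, and `0` otherwise. -/
noncomputable def pathMul {x y z t : V} (p : Path x y) (q : Path z t) : PathAlgebra k V :=
  if h : y = z then ofPath k (p.comp (q.cast h.symm rfl)) else 0

variable {k}

theorem pathMul_comp {x y z : V} (p : Path x y) (q : Path y z) :
    pathMul k p q = ofPath k (p.comp q) := by
  simp [pathMul]

theorem pathMul_ne {x y z t : V} (p : Path x y) (q : Path z t) (h : y ≠ z) :
    pathMul k p q = 0 := by
  simp [pathMul, h]

variable (k V) in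
/-- The multiplication of `kQ`, extended bilinearly from `pathMul`. -/
noncomputable def mulLinear : PathAlgebra k V →ₗ[k] PathAlgebra k V →ₗ[k] PathAlgebra k V :=
  extend k fun _ _ p => extend k fun _ _ q => pathMul k p q

noncomputable instance : Mul (PathAlgebra k V) := ⟨fun a b => mulLinear k V a b⟩

theorem mul_def (a b : PathAlgebra k V) : a * b = mulLinear k V a b := rfl

theorem ofPath_mul {x y z t : V} (p : Path x y) (q : Path z t) :
    ofPath k p * ofPath k q = pathMul k p q := by
  simp [mul_def, mulLinear]

theorem mul_assoc' (a b c : PathAlgebra k V) : a * b * c = a * (b * c) := by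
  have h1 : ∀ (x y : V) (p : Path x y) (z t : V) (q : Path z t) (c : PathAlgebra k V),
      ofPath k p * ofPath k q * c = ofPath k p * (ofPath k q * c) := by
    intro x y p z t q c
    have : mulLinear k V (ofPath k p * ofPath k q) =
        (mulLinear k V (ofPath k p)).comp (mulLinear k V (ofPath k q)) := by
      apply linearMap_ext
      intro s r l
      change ofPath k p * ofPath k q * ofPath k l = ofPath k p * (ofPath k q * ofPath k l)
      by_cases hyz : y = z
      · subst hyz
        by_cases hts : t = s
        · subst hts
          simp only [ofPath_mul, pathMul_comp, Path.comp_assoc]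
        · rw [ofPath_mul, pathMul_comp, ofPath_mul, ofPath_mul, pathMul_ne _ _ hts,
            pathMul_ne _ _ hts, mul_def, map_zero]
      · rw [ofPath_mul, pathMul_ne _ _ hyz, mul_def, map_zero, LinearMap.zero_apply, ofPath_mul]
        by_cases hts : t = s
        · subst hts
          rw [pathMul_comp, ofPath_mul, pathMul_ne _ _ hyz]
        · rw [pathMul_ne _ _ hts, mul_def, map_zero]
    exact LinearMap.congr_fun this c
  have h2 : ∀ (x y : V) (p : Path x y) (b c : PathAlgebra k V),
      ofPath k p * b * c = ofPath k p * (b * c) := by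
    intro x y p b c
    have : ((mulLinear k V).flip c).comp (mulLinear k V (ofPath k p)) =
        (mulLinear k V (ofPath k p)).comp ((mulLinear k V).flip c) := by
      apply linearMap_ext
      intro z t q
      exact h1 x y p z t q c
    exact LinearMap.congr_fun this b
  have : ((mulLinear k V).flip c).comp ((mulLinear k V).flip b) =
      (mulLinear k V).flip (b * c) := by
    apply linearMap_ext
    intro x y p
    exact h2 x y p b c
  exact LinearMap.congr_fun this a

variable (k V) in
/-- The unit of `kQ` for a quiver with finitely many vertices: the sum of the stationary paths. -/
noncomputable def pathUnit [Finite V] : PathAlgebra k V :=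
  ∑ᶠ x : V, ofPath k (Path.nil : Path x x)

theorem pathUnit_mul [Finite V] (a : PathAlgebra k V) : pathUnit k V * a = a := by
  classical
  have := Fintype.ofFinite V
  have h : mulLinear k V (pathUnit k V) = LinearMap.id := by
    apply linearMap_ext
    intro x y p
    rw [pathUnit, finsum_eq_sum_of_fintype, map_sum, LinearMap.sum_apply,
      Finset.sum_eq_single x]
    · change ofPath k _ * ofPath k p = _
      rw [ofPath_mul, pathMul_comp, Path.nil_comp]; rfl
    · intro z _ hz
      change ofPath k _ * ofPath k p = _
      rw [ofPath_mul, pathMul_ne _ _ hz]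
    · simp
  exact LinearMap.congr_fun h a

theorem mul_pathUnit [Finite V] (a : PathAlgebra k V) : a * pathUnit k V = a := by
  classical
  have := Fintype.ofFinite V
  have h : (mulLinear k V).flip (pathUnit k V) = LinearMap.id := by
    apply linearMap_ext
    intro x y p
    rw [pathUnit, finsum_eq_sum_of_fintype, map_sum, LinearMap.sum_apply,
      Finset.sum_eq_single y]
    · change ofPath k p * ofPath k _ = _
      rw [ofPath_mul, pathMul_comp, Path.comp_nil]; rfl
    · intro z _ hz
      change ofPath k p * ofPath k _ = _
      rw [ofPath_mul, pathMul_ne _ _ hz.symm]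
    · simp
  exact LinearMap.congr_fun h a

noncomputable instance [Finite V] : Ring (PathAlgebra k V) :=
  { (inferInstance : AddCommGroup (PathAlgebra k V)) with
    mul := fun a b => a * b
    one := pathUnit k V
    left_distrib := fun a b c => map_add (mulLinear k V a) b c
    right_distrib := fun a b c => LinearMap.map_add₂ (mulLinear k V) a b c
    zero_mul := fun a => LinearMap.map_zero₂ (mulLinear k V) a
    mul_zero := fun a => map_zero (mulLinear k V a)
    mul_assoc := mul_assoc'
    one_mul := pathUnit_mul
    mul_one := mul_pathUnit }

noncomputable instance [Finite V] : Algebra k (PathAlgebra k V) :=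
  Algebra.ofModule
    (fun r a b => LinearMap.map_smul₂ (mulLinear k V) r a b)
    (fun r a b => map_smul (mulLinear k V a) r b)

end PathAlgebra

/-! ### Admissible ideals, non-zero paths, minimal relations -/

section Ideals

variable {k : Type w} [Field k] {V : Type u} [Quiver.{v} V] [Finite V]

variable (k V) in
/-- The two-sided ideal `F` of `kQ` generated by the arrows. -/
noncomputable def arrowIdeal : TwoSidedIdeal (PathAlgebra k V) :=
  TwoSidedIdeal.span {a | ∃ (x y : V) (α : x ⟶ y), a = ofPath k α.toPath}

variable (k V) in
/-- The power `F ^ m`: the two-sided ideal generated by the products of `m` elements of `F`. -/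
noncomputable def arrowIdealPow (m : ℕ) : TwoSidedIdeal (PathAlgebra k V) :=
  TwoSidedIdeal.span
    {a | ∃ l : List (PathAlgebra k V), l.length = m ∧ (∀ b ∈ l, b ∈ arrowIdeal k V) ∧ a = l.prod}

/-- `I` is admissible if `F ^ m ⊆ I ⊆ F ^ 2` for some `m ≥ 2`. -/
def IsAdmissible (I : TwoSidedIdeal (PathAlgebra k V)) : Prop :=
  ∃ m : ℕ, 2 ≤ m ∧ arrowIdealPow k V m ≤ I ∧ I ≤ arrowIdealPow k V 2

/-- A path is non-zero if it does not lie in `I`. -/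
def IsNonzeroPath (I : TwoSidedIdeal (PathAlgebra k V)) {x y : V} (p : Path x y) : Prop :=
  ofPath k p ∉ I

/-- A linear combination `∑ r p • p` of parallel paths (with non-zero coefficients on the finite
set `r.support`) is a minimal relation if it lies in `I`, has at least two terms, and no non-empty
proper partial sum of it lies in `I`. -/
structure IsMinimalRelation (I : TwoSidedIdeal (PathAlgebra k V)) {x y : V}
    (r : Path x y →₀ k) : Prop where
  mem : ∑ p ∈ r.support, r p • ofPath k p ∈ I
  two_le : 2 ≤ r.support.card
  minimal : ∀ J : Finset (Path x y), J ⊂ r.support → J.Nonempty →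
    ∑ p ∈ J, r p • ofPath k p ∉ I

end Ideals

/-! ### Walks, homotopy and the fundamental group -/

section Homotopy

/-- A walk is a path in the quiver with a formal inverse added for every arrow. -/
abbrev Walk {V : Type u} [Quiver.{v} V] (x y : V) : Type (max u v) :=
  @Path (Symmetrify V) _ x y

/-- A path, seen as a walk. -/
def toWalk {V : Type u} [Quiver.{v} V] {x : V} : ∀ {y : V}, Path x y → Walk x y
  | _, Path.nil => Path.nil
  | _, Path.cons p α => Path.cons (toWalk p) α.toPos

variable {k : Type w} [Field k] {V : Type u} [Quiver.{v} V] [Finite V]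

/-- The homotopy relation on walks: the smallest equivalence relation that cancels an arrow with
its inverse, identifies the paths appearing in one minimal relation, and is compatible with
composition. -/
inductive Homotopic (I : TwoSidedIdeal (PathAlgebra k V)) :
    ∀ {x y : V}, Walk x y → Walk x y → Prop
  | refl {x y : V} (p : Walk x y) : Homotopic I p p
  | symm {x y : V} {p q : Walk x y} : Homotopic I p q → Homotopic I q p
  | trans {x y : V} {p q r : Walk x y} : Homotopic I p q → Homotopic I q r → Homotopic I p r
  | cancel_right {x y : V} (α : x ⟶ y) :
      Homotopic I (x := x) (y := x) (Path.comp α.toPos.toPath α.toNeg.toPath) Path.nil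
  | cancel_left {x y : V} (α : x ⟶ y) :
      Homotopic I (x := y) (y := y) (Path.comp α.toNeg.toPath α.toPos.toPath) Path.nil
  | minimal {x y : V} (r : Path x y →₀ k) (hr : IsMinimalRelation I r) (p q : Path x y)
      (hp : p ∈ r.support) (hq : q ∈ r.support) : Homotopic I (toWalk p) (toWalk q)
  | comp {x y z t : V} (l : Walk x y) {p q : Walk y z} (l' : Walk z t) :
      Homotopic I p q →
      Homotopic I (x := x) (y := t) (Path.comp (Path.comp l p) l') (Path.comp (Path.comp l q) l')

/-- The class of a walk in the fundamental groupoid of the underlying graph, that is, in the free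
groupoid on the quiver. -/
def walkClass {V : Type u} [Quiver.{v} V] {x : V} :
    ∀ {y : V}, Walk x y → ((FreeGroupoid.of V).obj x ⟶ (FreeGroupoid.of V).obj y)
  | _, Path.nil => 𝟙 _
  | _, Path.cons p (Sum.inl α) => walkClass p ≫ (FreeGroupoid.of V).map α
  | _, Path.cons p (Sum.inr α) => walkClass p ≫ Groupoid.inv ((FreeGroupoid.of V).map α)

/-- The fundamental group of the underlying graph of the quiver at the vertex `x₀`: the group of
loops at `x₀` in the free groupoid, with multiplication the composition of loops. -/
def GraphPi1 {V : Type u} [Quiver.{v} V] (x₀ : V) : Type (max u v) :=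
  (FreeGroupoid.of V).obj x₀ ⟶ (FreeGroupoid.of V).obj x₀

instance {V : Type u} [Quiver.{v} V] (x₀ : V) : Group (GraphPi1 x₀) :=
  Groupoid.vertexGroup ((FreeGroupoid.of V).obj x₀)

/-- The normal subgroup generated by the classes of `w u v⁻¹ w⁻¹`, where `w` is a walk from `x₀`
to `x` and `u`, `v` are homotopic paths from `x` to `y`. -/
def homotopySubgroup (I : TwoSidedIdeal (PathAlgebra k V)) (x₀ : V) : Subgroup (GraphPi1 x₀) :=
  Subgroup.normalClosure
    {g | ∃ (x y : V) (w : Walk x₀ x) (u v : Path x y), Homotopic I (toWalk u) (toWalk v) ∧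
      g = walkClass w ≫ walkClass (toWalk u) ≫ Groupoid.inv (walkClass (toWalk v)) ≫
        Groupoid.inv (walkClass w)}

instance (I : TwoSidedIdeal (PathAlgebra k V)) (x₀ : V) : (homotopySubgroup I x₀).Normal :=
  Subgroup.normalClosure_normal

/-- The fundamental group `π₁(Q, I)` of the bound quiver, at the base point `x₀`. -/
def Pi1 (I : TwoSidedIdeal (PathAlgebra k V)) (x₀ : V) : Type (max u v) :=
  GraphPi1 x₀ ⧸ homotopySubgroup I x₀

instance (I : TwoSidedIdeal (PathAlgebra k V)) (x₀ : V) : Group (Pi1 I x₀) :=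
  inferInstanceAs (Group (GraphPi1 x₀ ⧸ homotopySubgroup I x₀))

end Homotopy

/-! ### Functoriality -/

section Functoriality

section Graphs

variable {V : Type u} [Quiver.{v} V] {V' : Type u'} [Quiver.{v'} V']

/-- The action of a morphism of quivers on walks. -/
def mapWalk (φ : V ⥤q V') {x : V} : ∀ {y : V}, Walk x y → Walk (φ.obj x) (φ.obj y)
  | _, Path.nil => Path.nil
  | _, Path.cons p (Sum.inl α) => Path.cons (mapWalk φ p) (φ.map α).toPos
  | _, Path.cons p (Sum.inr α) => Path.cons (mapWalk φ p) (φ.map α).toNeg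

theorem mapWalk_comp (φ : V ⥤q V') {x y z : V} (p : Walk x y) (q : Walk y z) :
    mapWalk φ (x := x) (y := z) (Path.comp p q) =
      Path.comp (mapWalk φ p) (mapWalk φ q) := by
  revert q
  suffices h : ∀ (t : Symmetrify V) (q : @Path (Symmetrify V) _ y t),
      mapWalk φ (x := x) (y := t) (Path.comp p q) =
        Path.comp (mapWalk φ p) (mapWalk φ (x := y) (y := t) q) from h z
  intro t q
  induction q with
  | nil => rfl
  | cons q e ih =>
    rcases e with α | α
    · exact congrArg (fun l => Path.cons l (φ.map α).toPos) ih
    · exact congrArg (fun l => Path.cons l (φ.map α).toNeg) ih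

theorem mapWalk_toWalk (φ : V ⥤q V') {x y : V} (p : Path x y) :
    mapWalk φ (toWalk p) = toWalk (φ.mapPath p) := by
  induction p with
  | nil => rfl
  | cons p α ih =>
    exact congrArg (fun l => Path.cons l (φ.map α).toPos) ih

theorem functor_map_inv {C D : Type*} [Groupoid C] [Groupoid D] (F : C ⥤ D) {a b : C}
    (f : a ⟶ b) : F.map (Groupoid.inv f) = Groupoid.inv (F.map f) := by
  rw [Groupoid.inv_eq_inv, Groupoid.inv_eq_inv, Functor.map_inv]

theorem freeGroupoidFunctor_walkClass (φ : V ⥤q V') {x y : V} (p : Walk x y) :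
    (freeGroupoidFunctor φ).map (walkClass p) =
      walkClass (mapWalk φ p) := by
  have hof : ∀ {a b : V} (α : a ⟶ b), (freeGroupoidFunctor φ).map ((FreeGroupoid.of V).map α) =
      (FreeGroupoid.of V').map (φ.map α) := by
    intro a b α
    exact Category.id_comp _
  suffices h : ∀ (t : Symmetrify V) (q : @Path (Symmetrify V) _ x t),
      (freeGroupoidFunctor φ).map (walkClass (x := x) (y := t) q) =
        walkClass (mapWalk φ (x := x) (y := t) q) from h y p
  intro t q
  induction q with
  | nil => exact (freeGroupoidFunctor φ).map_id _
  | cons q e ih =>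
    rcases e with α | α
    · refine ((freeGroupoidFunctor φ).map_comp _ _).trans ?_
      rw [ih]
      exact congrArg (walkClass (mapWalk φ q) ≫ ·) (hof α)
    · refine ((freeGroupoidFunctor φ).map_comp _ _).trans ?_
      rw [ih, functor_map_inv]
      exact congrArg (fun β => walkClass (mapWalk φ q) ≫ Groupoid.inv β) (hof α)

/-- The homomorphism of fundamental groups of graphs induced by a morphism of quivers. -/
def graphPi1Map (φ : V ⥤q V') (x₀ : V) : GraphPi1 x₀ →* GraphPi1 (φ.obj x₀) :=
  (freeGroupoidFunctor φ).mapVertexGroup ((FreeGroupoid.of V).obj x₀)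

end Graphs

variable {k : Type w} [Field k] {V : Type u} [Quiver.{v} V] [Finite V]
  {V' : Type u'} [Quiver.{v'} V'] [Finite V']

/-- The linear map of path algebras that a morphism of quivers induces. -/
noncomputable def pathAlgebraLinearMap (k : Type w) [Field k] (φ : V ⥤q V') :
    PathAlgebra k V →ₗ[k] PathAlgebra k V' :=
  extend k fun _ _ p => ofPath k (φ.mapPath p)

theorem pathAlgebraLinearMap_ofPath (φ : V ⥤q V') {x y : V} (p : Path x y) :
    pathAlgebraLinearMap k φ (ofPath k p) = ofPath k (φ.mapPath p) :=
  extend_ofPath _ p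

/-- The map of path algebras induced by a morphism of quivers that is injective on vertices. It is
multiplicative, but it preserves the unit only when the morphism is surjective on vertices. -/
noncomputable def pathAlgebraMap (φ : V ⥤q V') (hφ : Function.Injective φ.obj) :
    PathAlgebra k V →ₙₐ[k] PathAlgebra k V' :=
  { pathAlgebraLinearMap k φ with
    map_zero' := map_zero (pathAlgebraLinearMap k φ)
    map_mul' := by
      intro a b
      let f := pathAlgebraLinearMap k φ
      change f (a * b) = f a * f b
      have h1 : ∀ (x y : V) (p : Path x y) (b : PathAlgebra k V),
          f (ofPath k p * b) = f (ofPath k p) * f b := by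
        intro x y p b
        have : f.comp (mulLinear k V (ofPath k p)) =
            (mulLinear k V' (f (ofPath k p))).comp f := by
          apply linearMap_ext
          intro z t q
          change f (ofPath k p * ofPath k q) = f (ofPath k p) * f (ofPath k q)
          by_cases h : y = z
          · subst h
            rw [ofPath_mul, pathMul_comp]
            simp only [f, pathAlgebraLinearMap_ofPath, ofPath_mul, pathMul_comp, Prefunctor.mapPath_comp]
          · rw [ofPath_mul, pathMul_ne _ _ h, map_zero]
            simp only [f, pathAlgebraLinearMap_ofPath]
            rw [ofPath_mul, pathMul_ne _ _ (fun e => h (hφ e))]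
        exact LinearMap.congr_fun this b
      have : f.comp ((mulLinear k V).flip b) = ((mulLinear k V').flip (f b)).comp f := by
        apply linearMap_ext
        intro x y p
        exact h1 x y p b
      exact LinearMap.congr_fun this a }

@[simp] theorem pathAlgebraMap_ofPath (φ : V ⥤q V') (hφ : Function.Injective φ.obj) {x y : V}
    (p : Path x y) : pathAlgebraMap (k := k) φ hφ (ofPath k p) = ofPath k (φ.mapPath p) :=
  pathAlgebraLinearMap_ofPath φ p

/-- The homomorphism of fundamental groups induced by a morphism of quivers that respects the
homotopy relations. -/
noncomputable def pi1Map (φ : V ⥤q V') (I : TwoSidedIdeal (PathAlgebra k V))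
    (I' : TwoSidedIdeal (PathAlgebra k V'))
    (h : ∀ (x y : V) (p q : Walk x y), Homotopic I p q →
      Homotopic I' (mapWalk φ p) (mapWalk φ q))
    (x₀ : V) : Pi1 I x₀ →* Pi1 I' (φ.obj x₀) :=
  QuotientGroup.map (homotopySubgroup I x₀) (homotopySubgroup I' (φ.obj x₀))
    (graphPi1Map φ x₀) (by
      refine Subgroup.normalClosure_le_normal
        (N := (homotopySubgroup I' (φ.obj x₀)).comap (graphPi1Map φ x₀)) ?_
      rintro _ ⟨x, y, w, p, q, hpq, rfl⟩
      apply Subgroup.subset_normalClosure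
      refine ⟨φ.obj x, φ.obj y, mapWalk φ w, φ.mapPath p, φ.mapPath q, ?_, ?_⟩
      · have := h x y _ _ hpq
        rwa [mapWalk_toWalk, mapWalk_toWalk] at this
      · rw [← mapWalk_toWalk, ← mapWalk_toWalk,
          ← freeGroupoidFunctor_walkClass, ← freeGroupoidFunctor_walkClass,
          ← freeGroupoidFunctor_walkClass]
        change (freeGroupoidFunctor φ).map _ = _
        rw [Functor.map_comp, Functor.map_comp, Functor.map_comp, functor_map_inv,
          functor_map_inv]
        rfl)

end Functoriality

/-! ### Full convex subquivers -/

section FullSubquivers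

/-- The full subquiver on a set `S` of vertices. -/
@[ext]
structure Full {V : Type u} (S : Set V) : Type u where
  /-- the underlying vertex of `Q` -/
  val : V
  /-- it lies in the given set -/
  property : val ∈ S

instance {V : Type u} [Quiver.{v} V] (S : Set V) : Quiver.{v} (Full S) :=
  ⟨fun x y => x.val ⟶ y.val⟩

instance {V : Type u} [Finite V] (S : Set V) : Finite (Full S) :=
  Finite.of_injective (Full.val : Full S → V) fun _ _ => Full.ext

variable {k : Type w} [Field k] {V : Type u} [Quiver.{v} V] [Finite V]

/-- The inclusion of a full subquiver. -/
def fullIncl (S : Set V) : Full S ⥤q V where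
  obj x := x.1
  map α := α

/-- The inclusion of a full subquiver in a larger one. -/
def fullInclOfSubset {S T : Set V} (h : S ⊆ T) : Full S ⥤q Full T where
  obj x := ⟨x.1, h x.2⟩
  map α := α

/-- A path lies entirely in the full subquiver on `S` if it only visits vertices of `S`. -/
def LiesIn {x y : V} (p : Path x y) (S : Set V) : Prop :=
  ∀ z ∈ p.vertices, z ∈ S

/-- The full subquiver on `S` is convex if every path between two of its vertices lies in it. -/
def IsConvex (S : Set V) : Prop :=
  ∀ ⦃x y : V⦄, x ∈ S → y ∈ S → ∀ p : Path x y, LiesIn p S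

/-- A quiver is connected if its underlying graph is: it is non-empty and any two vertices are
joined by a walk. -/
def IsConnected (W : Type*) [Quiver W] : Prop :=
  Nonempty W ∧ ∀ x y : W, Nonempty (Walk x y)

/-- The restriction `I ∩ kQ'` of an ideal `I` of `kQ` to the full subquiver `Q'` on `S`. -/
noncomputable def restrict (I : TwoSidedIdeal (PathAlgebra k V)) (S : Set V) :
    TwoSidedIdeal (PathAlgebra k (Full S)) :=
  TwoSidedIdeal.comap (pathAlgebraMap (k := k) (fullIncl S) (fun _ _ => Full.ext)) I

/-- If a morphism of quivers is injective on paths and a linear combination of paths lies in `I`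
exactly when its image lies in `I'`, then homotopies are preserved. -/
theorem Homotopic.map {V' : Type u'} [Quiver.{v'} V'] [Finite V'] (φ : V ⥤q V')
    (hinj : ∀ x y : V, Function.Injective (φ.mapPath : Path x y → _))
    {I : TwoSidedIdeal (PathAlgebra k V)} {I' : TwoSidedIdeal (PathAlgebra k V')}
    (hI : ∀ (x y : V) (s : Finset (Path x y)) (c : Path x y → k),
      ∑ p ∈ s, c p • ofPath k p ∈ I ↔ ∑ p ∈ s, c p • ofPath k (φ.mapPath p) ∈ I')
    {x y : V} {p q : Walk x y} (h : Homotopic I p q) :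
    Homotopic I' (mapWalk φ p) (mapWalk φ q) := by
  classical
  induction h with
  | refl p => exact .refl _
  | symm _ ih => exact .symm ih
  | trans _ _ ih₁ ih₂ => exact .trans ih₁ ih₂
  | cancel_right α => exact .cancel_right (φ.map α)
  | cancel_left α => exact .cancel_left (φ.map α)
  | @minimal x y r hr p q hp hq =>
    rw [mapWalk_toWalk, mapWalk_toWalk]
    let e : Path x y ↪ Path (φ.obj x) (φ.obj y) := ⟨φ.mapPath, hinj x y⟩
    have hv : ∀ p, r.embDomain e (φ.mapPath p) = r p := fun p => Finsupp.embDomain_apply_self e r p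
    have hs : (r.embDomain e).support = r.support.map e := Finsupp.support_embDomain e r
    refine .minimal (r.embDomain e) ⟨?_, ?_, ?_⟩ _ _ ?_ ?_
    · rw [hs, Finset.sum_map]
      simp only [e, Function.Embedding.coeFn_mk, hv]
      exact (hI x y _ _).1 hr.mem
    · rw [hs, Finset.card_map]; exact hr.two_le
    · intro J hJ hJne
      rw [hs] at hJ
      obtain ⟨J, hJ', rfl⟩ := Finset.subset_map_iff.1 hJ.1
      rw [Finset.sum_map]
      simp only [e, Function.Embedding.coeFn_mk, hv]
      rw [← hI]
      refine hr.minimal J ⟨hJ', fun h => hJ.2 (Finset.map_subset_map.2 h)⟩ ?_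
      simpa using hJne
    · rw [hs]; exact Finset.mem_map_of_mem e hp
    · rw [hs]; exact Finset.mem_map_of_mem e hq
  | comp l l' _ ih =>
    rw [mapWalk_comp, mapWalk_comp, mapWalk_comp, mapWalk_comp]
    exact .comp _ _ ih

theorem mapPath_injective {V : Type u} [Quiver.{v} V] {V' : Type u'} [Quiver.{v'} V'] (φ : V ⥤q V')
    (hobj : Function.Injective φ.obj)
    (hmap : ∀ x y : V, Function.Injective (φ.map : (x ⟶ y) → _)) (x y : V) :
    Function.Injective (φ.mapPath : Path x y → _) := by
  intro p
  induction p with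
  | nil =>
    intro q h
    have hl : ∀ {b : V} (q : Path x b), (φ.mapPath q).length = q.length := by
      intro b q
      induction q with
      | nil => rfl
      | cons q α ih => simp [ih]
    have := congrArg Path.length h
    rw [hl, hl] at this
    exact (Path.eq_nil_of_length_zero q this.symm).symm
  | @cons b c p α ih =>
    intro q h
    cases q with
    | nil => simp at h
    | @cons b' _ q β =>
      rw [Prefunctor.mapPath_cons, Prefunctor.mapPath_cons] at h
      obtain rfl : b = b' := hobj (Path.obj_eq_of_cons_eq_cons h)
      rw [ih (eq_of_heq (Path.heq_of_cons_eq_cons h)),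
        hmap _ _ (eq_of_heq (Path.hom_heq_of_cons_eq_cons h))]

theorem mem_restrict_iff (I : TwoSidedIdeal (PathAlgebra k V)) (S : Set V) {ι : Type*}
    {x y : Full S} (s : Finset ι) (c : ι → k) (p : ι → Path x y) :
    ∑ i ∈ s, c i • ofPath k (p i) ∈ restrict I S ↔
      ∑ i ∈ s, c i • ofPath k ((fullIncl S).mapPath (p i)) ∈ I := by
  rw [restrict, TwoSidedIdeal.mem_comap, map_sum]
  have h : ∀ i, pathAlgebraMap (k := k) (fullIncl S) (fun _ _ => Full.ext) (c i • ofPath k (p i)) =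
      c i • ofPath k ((fullIncl S).mapPath (p i)) := fun i =>
    (map_smul _ _ _).trans (congrArg _ (pathAlgebraMap_ofPath _ _ _))
  rw [Finset.sum_congr rfl fun i _ => h i]

/-- The homomorphism `π₁(Q', I ∩ kQ') → π₁(Q, I)` induced by the inclusion of the full subquiver
`Q'` on `S`. -/
noncomputable def pi1Incl (I : TwoSidedIdeal (PathAlgebra k V)) (S : Set V) (x₀ : Full S) :
    Pi1 (restrict I S) x₀ →* Pi1 I x₀.1 :=
  pi1Map (fullIncl S) (restrict I S) I
    (fun _ _ _ _ h => h.map (fullIncl S)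
      (mapPath_injective _ (fun _ _ => Full.ext) fun _ _ _ _ e => e)
      (fun _ _ s c => mem_restrict_iff I S s c id)) x₀

/-- The homomorphism `π₁(Q', I ∩ kQ') → π₁(Q'', I ∩ kQ'')` induced by the inclusion of the full
subquiver `Q'` on `S` in the full subquiver `Q''` on `T`, for `S ⊆ T`. -/
noncomputable def pi1InclOfSubset (I : TwoSidedIdeal (PathAlgebra k V)) {S T : Set V}
    (hST : S ⊆ T) (x₀ : Full S) :
    Pi1 (restrict I S) x₀ →* Pi1 (restrict I T) (⟨x₀.1, hST x₀.2⟩ : Full T) :=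
  pi1Map (fullInclOfSubset hST) (restrict I S) (restrict I T)
    (fun _ _ _ _ h => h.map (fullInclOfSubset hST)
      (mapPath_injective _
        (fun a b e => Full.ext (congrArg Full.val e : (_ : V) = _)) fun _ _ _ _ e => e)
      (fun _ _ s c => by
        refine (mem_restrict_iff I S s c id).trans
          (Iff.trans ?_ (mem_restrict_iff I T s c _).symm)
        simp only [← Prefunctor.mapPath_comp_apply, id]
        rfl)) x₀

end FullSubquivers

end BoundQuiver

/-! The relations of $Q$ are those of the two pieces. A path in a minimal relation is non-zero,
because a singleton is a proper non-empty subfamily of a sum with at least two terms. It therefore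
lies in some $Q^i$, and its endpoints do too. Convexity then drags every parallel path into $Q^i$,
so the whole relation is a minimal relation of $I^i$ (`IsMinimalRelation.exists_restrict`). What
remains is van Kampen's theorem for graphs, in the language of free groupoids; $Q^1$, $Q^2$ and $Q$
need not be connected, only $Q^0$.

Existence (`exists_pi1_hom`): choose an arrow of the free groupoid from $x_0$ to each reachable
vertex of $Q^i$, coming from $Q^0$ when the vertex lies there. A homomorphism on the vertex group
then extends to a functor to a group. Compatible homomorphisms give functors that agree on the
arrows of $Q^0$, so they glue to a functor on the free groupoid of $Q$
(`exists_functor_of_compatible`). This functor respects minimal relations, hence homotopy, and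
descends to $\pi_1(Q,I,x_0)$.

Uniqueness (`graphPi1_hom_ext`): a loop is cut at each passage between the pieces, and the cut
points are joined to $x_0$ inside $Q^0$. This needs every arrow to lie in one piece, which holds
because $I\subseteq F^2$ makes arrows non-zero. -/

namespace BoundQuiver

open Quiver hiding SingleObj
open CategoryTheory
open MulOpposite

universe w u v u' v'

/-! ### The length filtration of the path algebra: arrows are non-zero. -/

section LengthFiltration

variable {k : Type w} [Field k] {V : Type u} [Quiver.{v} V]

variable (k V) in
/-- The subspace of `kQ` spanned by the paths of length at least `n`. -/
noncomputable def longPaths (n : ℕ) : Submodule k (PathAlgebra k V) :=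
  Submodule.span k {a | ∃ (x y : V) (p : Path x y), n ≤ p.length ∧ a = ofPath k p}

theorem ofPath_mem_longPaths {x y : V} (p : Path x y) {n : ℕ} (h : n ≤ p.length) :
    ofPath k p ∈ longPaths k V n :=
  Submodule.subset_span ⟨x, y, p, h, rfl⟩

/-- The coordinate functional at `p` kills all paths of length at least `n` if `p` itself is
shorter, but it takes the value 1 on `p`. -/
theorem length_of_ofPath_mem_longPaths {x y : V} (p : Path x y) {n : ℕ}
    (h : ofPath k p ∈ longPaths k V n) : n ≤ p.length := by
  by_contra hn
  let f : PathAlgebra k V →ₗ[k] k := Finsupp.lapply (⟨x, y, p⟩ : AllPaths V)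
  have hf : longPaths k V n ≤ LinearMap.ker f := by
    refine Submodule.span_le.2 ?_
    rintro _ ⟨x', y', q, hq, rfl⟩
    refine Finsupp.single_eq_of_ne ?_
    intro e
    cases e
    exact hn hq
  have h1 : f (ofPath k p) = 1 := Finsupp.single_eq_same
  have h0 : f (ofPath k p) = 0 := hf h
  exact one_ne_zero (h1.symm.trans h0)

theorem mul_mem_longPaths {m n : ℕ} {a b : PathAlgebra k V} (ha : a ∈ longPaths k V m)
    (hb : b ∈ longPaths k V n) : a * b ∈ longPaths k V (m + n) := by
  have h : longPaths k V m ≤ (longPaths k V (m + n)).comap ((mulLinear k V).flip b) := by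
    refine Submodule.span_le.2 ?_
    rintro _ ⟨x, y, p, hp, rfl⟩
    have h' : longPaths k V n ≤ (longPaths k V (m + n)).comap (mulLinear k V (ofPath k p)) := by
      refine Submodule.span_le.2 ?_
      rintro _ ⟨z, t, q, hq, rfl⟩
      change ofPath k p * ofPath k q ∈ longPaths k V (m + n)
      rw [ofPath_mul]
      by_cases hyz : y = z
      · subst hyz
        rw [pathMul_comp]
        exact ofPath_mem_longPaths _ (by rw [Path.length_comp]; omega)
      · rw [pathMul_ne _ _ hyz]
        exact Submodule.zero_mem _
    exact h' hb
  exact h ha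

theorem mem_longPaths_zero (a : PathAlgebra k V) : a ∈ longPaths k V 0 := by
  induction a using Finsupp.induction_linear with
  | zero => exact Submodule.zero_mem _
  | add f g hf hg => exact Submodule.add_mem _ hf hg
  | single p c =>
    have h := Submodule.smul_mem _ c (ofPath_mem_longPaths (k := k) p.2.2 (Nat.zero_le _))
    have e : c • ofPath k p.2.2 = Finsupp.single p c :=
      (Finsupp.smul_single c p (1 : k)).trans (by rw [smul_eq_mul, mul_one])
    rwa [e] at h

variable [Finite V]

variable (k V) in
/-- The paths of length at least `n` span a two-sided ideal. -/
noncomputable def longPathsIdeal (n : ℕ) : TwoSidedIdeal (PathAlgebra k V) :=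
  TwoSidedIdeal.mk' (longPaths k V n) (Submodule.zero_mem _)
    (fun ha hb => Submodule.add_mem _ ha hb) (fun ha => Submodule.neg_mem _ ha)
    (fun {a b} hb => by
      have := mul_mem_longPaths (mem_longPaths_zero a) hb
      rwa [zero_add] at this)
    (fun {a b} ha => by
      have := mul_mem_longPaths ha (mem_longPaths_zero b)
      rwa [add_zero] at this)

theorem mem_longPathsIdeal {n : ℕ} {a : PathAlgebra k V} :
    a ∈ longPathsIdeal k V n ↔ a ∈ longPaths k V n :=
  TwoSidedIdeal.mem_mk' ..

theorem arrowIdeal_le_longPathsIdeal : arrowIdeal k V ≤ longPathsIdeal k V 1 := by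
  refine TwoSidedIdeal.span_le.2 ?_
  rintro _ ⟨x, y, α, rfl⟩
  exact mem_longPathsIdeal.2 (ofPath_mem_longPaths _ le_rfl)

theorem list_prod_mem_longPaths (l : List (PathAlgebra k V)) (h : ∀ b ∈ l, b ∈ arrowIdeal k V) :
    l.prod ∈ longPaths k V l.length := by
  induction l with
  | nil => exact mem_longPaths_zero _
  | cons a l ih =>
    rw [List.prod_cons, List.length_cons, add_comm]
    exact mul_mem_longPaths
      (mem_longPathsIdeal.1 (arrowIdeal_le_longPathsIdeal (h a (by simp))))
      (ih fun b hb => h b (by simp [hb]))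

theorem arrowIdealPow_le_longPathsIdeal (n : ℕ) :
    arrowIdealPow k V n ≤ longPathsIdeal k V n := by
  refine TwoSidedIdeal.span_le.2 ?_
  rintro _ ⟨l, rfl, hl, rfl⟩
  exact mem_longPathsIdeal.2 (list_prod_mem_longPaths l hl)

/-- Only the inclusion $I\subseteq F^2$ matters: elements of $F^2$ are combinations of paths of
length at least 2. Applied to arrows, this turns the cover of non-zero paths into a cover of arrows.
-/
theorem IsAdmissible.isNonzeroPath {I : TwoSidedIdeal (PathAlgebra k V)} (hI : IsAdmissible I)
    {x y : V} (p : Path x y) (hp : p.length < 2) : IsNonzeroPath I p := by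
  obtain ⟨_, _, _, h⟩ := hI
  intro hmem
  have := length_of_ofPath_mem_longPaths p
    (mem_longPathsIdeal.1 (arrowIdealPow_le_longPathsIdeal 2 (h hmem)))
  omega

end LengthFiltration

/-! ### Restricting minimal relations to convex subquivers. -/

section Restriction

variable {V : Type u} [Quiver.{v} V]

theorem LiesIn.exists_lift {S : Set V} {x y : V} (p : Path x y) (h : LiesIn p S) (hx : x ∈ S)
    (hy : y ∈ S) :
    ∃ p' : Path (⟨x, hx⟩ : Full S) ⟨y, hy⟩, (fullIncl S).mapPath p' = p := by
  induction p with
  | nil => exact ⟨Path.nil, rfl⟩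
  | @cons b c p α ih =>
    have hp : LiesIn p S := fun z hz => h z ((Path.mem_vertices_cons p α).2 (Or.inl hz))
    have hb : b ∈ S := hp b (Path.end_mem_vertices p)
    obtain ⟨p', rfl⟩ := ih hp hb
    exact ⟨@Path.cons (Full S) _ _ ⟨b, hb⟩ ⟨c, hy⟩ p' α, rfl⟩

theorem fullIncl_mapPath_injective (S : Set V) (x y : Full S) :
    Function.Injective ((fullIncl S).mapPath : Path x y → _) :=
  mapPath_injective _ (fun _ _ => Full.ext) (fun _ _ _ _ e => e) x y

variable {k : Type w} [Field k] [Finite V] {I : TwoSidedIdeal (PathAlgebra k V)}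

theorem IsMinimalRelation.isNonzeroPath {x y : V} {r : Path x y →₀ k}
    (hr : IsMinimalRelation I r) {p : Path x y} (hp : p ∈ r.support) : IsNonzeroPath I p := by
  intro hmem
  refine hr.minimal {p} ⟨by simpa using hp, fun h => ?_⟩ (Finset.singleton_nonempty p) ?_
  · have := (Finset.card_le_card h).trans_eq (Finset.card_singleton p)
    have := hr.two_le
    omega
  · rw [Finset.sum_singleton]
    -- A two-sided ideal is closed under multiplication by ring elements, so the scalar is rewritten
    -- as a left factor.
    have h : r p • ofPath k p = (r p • (1 : PathAlgebra k V)) * ofPath k p := by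
      rw [smul_mul_assoc, one_mul]
    rw [h]
    exact I.mul_mem_left _ _ hmem

/-- Every minimal relation between two vertices of a convex full subquiver comes from a minimal
relation of this subquiver. -/
theorem IsMinimalRelation.exists_restrict {S : Set V} (hS : IsConvex S) {x y : V}
    {r : Path x y →₀ k} (hr : IsMinimalRelation I r) (hx : x ∈ S) (hy : y ∈ S) :
    ∃ r' : Path (⟨x, hx⟩ : Full S) ⟨y, hy⟩ →₀ k, IsMinimalRelation (restrict I S) r' ∧
      ∀ p ∈ r.support, ∃ p' ∈ r'.support, (fullIncl S).mapPath p' = p := by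
  classical
  let e : Path (⟨x, hx⟩ : Full S) ⟨y, hy⟩ ↪ Path x y :=
    ⟨(fullIncl S).mapPath, fullIncl_mapPath_injective S _ _⟩
  -- Convexity enters here: all paths from `x` to `y` lift, so `r` is the pushforward of a
  -- combination of paths of the subquiver.
  have hsurj : ∀ p : Path x y, ∃ p', e p' = p := fun p => (hS hx hy p).exists_lift p hx hy
  obtain ⟨r', rfl⟩ : ∃ r' : Path (⟨x, hx⟩ : Full S) ⟨y, hy⟩ →₀ k, r'.embDomain e = r := by
    refine ⟨r.comapDomain e e.injective.injOn, Finsupp.ext fun p => ?_⟩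
    obtain ⟨p', rfl⟩ := hsurj p
    rw [Finsupp.embDomain_apply_self, Finsupp.comapDomain_apply]
  have hs := Finsupp.support_embDomain e r'
  have hsum : ∀ J : Finset (Path (⟨x, hx⟩ : Full S) ⟨y, hy⟩),
      ∑ p ∈ J, r' p • ofPath k p ∈ restrict I S ↔
        ∑ p ∈ J.map e, r'.embDomain e p • ofPath k p ∈ I := by
    intro J
    rw [Finset.sum_map]
    simp only [Finsupp.embDomain_apply_self]
    exact mem_restrict_iff I S J r' id
  refine ⟨r', ⟨?_, ?_, ?_⟩, ?_⟩
  · rw [hsum, ← hs]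
    exact hr.mem
  · have := hr.two_le
    rwa [hs, Finset.card_map] at this
  · intro J hJ hne
    rw [hsum]
    exact hr.minimal _ (by rw [hs]; exact Finset.map_ssubset_map.2 hJ) (hne.map)
  · intro p hp
    rw [hs, Finset.mem_map] at hp
    exact hp

end Restriction

/-! ### Free groupoids and extension of homomorphisms from a vertex group. -/

section FreeGroupoids

variable {W : Type u} [Quiver.{v} W]

theorem walkClass_comp {x y z : W} (p : Walk x y) (q : Walk y z) :
    walkClass (x := x) (y := z) (Path.comp p q) = walkClass p ≫ walkClass q := by
  suffices h : ∀ (t : Symmetrify W) (q : @Path (Symmetrify W) _ y t),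
      walkClass (x := x) (y := t) (Path.comp p q) =
        walkClass p ≫ walkClass (x := y) (y := t) q from h z q
  intro t q
  induction q with
  | nil => exact (Category.comp_id _).symm
  | cons q e ih =>
    rcases e with α | α
    · exact (congrArg (· ≫ (FreeGroupoid.of W).map α) ih).trans (Category.assoc _ _ _)
    · exact (congrArg (· ≫ Groupoid.inv ((FreeGroupoid.of W).map α)) ih).trans
        (Category.assoc _ _ _)

theorem walkClass_surjective (x y : W) :
    Function.Surjective (walkClass : Walk x y → _) := by
  -- An arrow of the free groupoid is by construction a class of walks modulo cancellation.
  suffices h : ∀ (t : Symmetrify W) (q : @Path (Symmetrify W) _ x t),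
      walkClass (x := x) (y := t) q = Quot.mk _ q by
    intro f
    obtain ⟨q, rfl⟩ := Quot.exists_rep f
    exact ⟨q, h y q⟩
  intro t q
  induction q with
  | nil => rfl
  | cons q e ih =>
    rcases e with α | α
    · exact congrArg (· ≫ (FreeGroupoid.of W).map α) ih
    · exact congrArg (· ≫ Groupoid.inv ((FreeGroupoid.of W).map α)) ih

variable {G : Type*} [Group G]

open Classical in
/-- A homomorphism from the vertex group of a free groupoid at `x₀` extends to a functor on the
whole groupoid, by means of a choice of arrows from `x₀`. The functor is trivial on the components
that do not contain `x₀`. -/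
noncomputable def extendVertexHom {x₀ : W} (φ : GraphPi1 x₀ →* G)
    (T : ∀ y : Quiver.FreeGroupoid W, Nonempty ((FreeGroupoid.of W).obj x₀ ⟶ y) →
      ((FreeGroupoid.of W).obj x₀ ⟶ y)) :
    Quiver.FreeGroupoid W ⥤ SingleObj Gᵐᵒᵖ where
  obj _ := CategoryTheory.SingleObj.star _
  -- The arrow is closed up to a loop at `x₀` by the chosen arrows. Composition in `SingleObj`
  -- reverses products while loops multiply in the order of composition, hence the opposite group.
  map {x y} g := if h : Nonempty ((FreeGroupoid.of W).obj x₀ ⟶ x) then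
    op (φ (T x h ≫ g ≫ inv (T y ⟨h.some ≫ g⟩))) else (1 : Gᵐᵒᵖ)
  map_id x := by
    split_ifs with h
    · have : T x h ≫ 𝟙 x ≫ inv (T x h) = 𝟙 _ := by simp
      exact congrArg op ((congrArg φ this).trans (map_one φ))
    · rfl
  map_comp {x y z} f g := by
    by_cases h : Nonempty ((FreeGroupoid.of W).obj x₀ ⟶ x)
    · have hy : Nonempty ((FreeGroupoid.of W).obj x₀ ⟶ y) := ⟨h.some ≫ f⟩
      have hz : Nonempty ((FreeGroupoid.of W).obj x₀ ⟶ z) := ⟨h.some ≫ f ≫ g⟩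
      rw [dif_pos h, dif_pos h, dif_pos hy]
      have : T x h ≫ (f ≫ g) ≫ inv (T z hz) =
          (T x h ≫ f ≫ inv (T y hy)) ≫ (T y hy ≫ g ≫ inv (T z hz)) := by simp
      exact congrArg op ((congrArg φ this).trans (map_mul φ _ _))
    · have hy : ¬ Nonempty ((FreeGroupoid.of W).obj x₀ ⟶ y) :=
        fun ⟨t⟩ => h ⟨t ≫ inv f⟩
      rw [dif_neg h, dif_neg h, dif_neg hy]
      exact (one_mul (1 : Gᵐᵒᵖ)).symm

variable {x₀ : W} (φ : GraphPi1 x₀ →* G)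
  (T : ∀ y : Quiver.FreeGroupoid W, Nonempty ((FreeGroupoid.of W).obj x₀ ⟶ y) →
      ((FreeGroupoid.of W).obj x₀ ⟶ y))

theorem extendVertexHom_map {x y : Quiver.FreeGroupoid W} (g : x ⟶ y)
    (h : Nonempty ((FreeGroupoid.of W).obj x₀ ⟶ x))
    (h' : Nonempty ((FreeGroupoid.of W).obj x₀ ⟶ y)) :
    (extendVertexHom φ T).map g = op (φ (T x h ≫ g ≫ inv (T y h'))) :=
  dif_pos h

theorem extendVertexHom_map_loop (hT : ∀ h, T _ h = 𝟙 _) (g : GraphPi1 x₀) :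
    (extendVertexHom φ T).map g = op (φ g) := by
  have h : Nonempty ((FreeGroupoid.of W).obj x₀ ⟶ (FreeGroupoid.of W).obj x₀) := ⟨𝟙 _⟩
  rw [extendVertexHom_map φ T g h h, hT]
  have : 𝟙 _ ≫ g ≫ inv (𝟙 ((FreeGroupoid.of W).obj x₀)) = g := by
    rw [IsIso.inv_id]
    exact (Category.id_comp _).trans (Category.comp_id _)
  exact congrArg (fun a => op (φ a)) this

/-- The loops closing up `u` and `v` differ by the conjugate of $uv^{-1}$ by the chosen arrow to
`x`. On the other components both values are 1. -/
theorem extendVertexHom_map_eq {x y : Quiver.FreeGroupoid W} (u v : x ⟶ y)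
    (huv : ∀ t : (FreeGroupoid.of W).obj x₀ ⟶ x, φ (t ≫ u ≫ inv v ≫ inv t) = 1) :
    (extendVertexHom φ T).map u = (extendVertexHom φ T).map v := by
  by_cases h : Nonempty ((FreeGroupoid.of W).obj x₀ ⟶ x)
  · have h' : Nonempty ((FreeGroupoid.of W).obj x₀ ⟶ y) := ⟨h.some ≫ u⟩
    rw [extendVertexHom_map φ T u h h', extendVertexHom_map φ T v h h']
    have : T x h ≫ u ≫ inv (T y h') =
        (T x h ≫ u ≫ inv v ≫ inv (T x h)) ≫ (T x h ≫ v ≫ inv (T y h')) := by simp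
    refine congrArg op ((congrArg φ this).trans ((map_mul φ _ _).trans ?_))
    rw [huv, one_mul]
  · exact (dif_neg h : (extendVertexHom φ T).map u = (1 : Gᵐᵒᵖ)).trans
      (dif_neg h : (extendVertexHom φ T).map v = (1 : Gᵐᵒᵖ)).symm

end FreeGroupoids

/-! ### Gluing functors along a cover by full subquivers. -/

section VanKampen

variable {V : Type u} [Quiver.{v} V] {ι : Type*} {S : ι → Set V} {S₀ : Set V}
  {G : Type*} [Group G]

theorem freeGroupoidFunctor_map_of {V' : Type u'} [Quiver.{v'} V'] (φ : V ⥤q V') {x y : V}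
    (α : x ⟶ y) : (freeGroupoidFunctor φ).map ((FreeGroupoid.of V).map α) =
      (FreeGroupoid.of V').map (φ.map α) :=
  Category.id_comp _

theorem freeGroupoidFunctor_map_map {V' : Type*} [Quiver V'] {V'' : Type*} [Quiver V'']
    (φ : V ⥤q V') (φ' : V' ⥤q V'') {x y : Quiver.FreeGroupoid V} (f : x ⟶ y) :
    (freeGroupoidFunctor φ').map ((freeGroupoidFunctor φ).map f) =
      (freeGroupoidFunctor (φ ⋙q φ')).map f := by
  have h := Functor.congr_hom (freeGroupoidFunctor_comp φ φ') f
  refine (h.trans ?_).symm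
  exact (Category.id_comp _).trans (Category.comp_id _)

/-- Functors on the free groupoids of the members of a family of full subquivers, which agree on
the common arrows, glue to a functor on the free groupoid of the whole quiver. -/
theorem exists_functor_of_cover {M : Type*} [Group M]
    (Ψ : ∀ i, Quiver.FreeGroupoid (Full (S i)) ⥤ SingleObj M)
    (hΨ : ∀ (i j : ι) (x y : V) (α : x ⟶ y) (hxi : x ∈ S i) (hyi : y ∈ S i) (hxj : x ∈ S j)
      (hyj : y ∈ S j),
      ((Ψ i).map ((FreeGroupoid.of (Full (S i))).map
        (show (⟨x, hxi⟩ : Full (S i)) ⟶ ⟨y, hyi⟩ from α)) : M) =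
      (Ψ j).map ((FreeGroupoid.of (Full (S j))).map
        (show (⟨x, hxj⟩ : Full (S j)) ⟶ ⟨y, hyj⟩ from α))) :
    ∃ Φ : Quiver.FreeGroupoid V ⥤ SingleObj M,
      ∀ i, freeGroupoidFunctor (fullIncl (S i)) ⋙ Φ = Ψ i := by
  classical
  let P : V ⥤q SingleObj M :=
    { obj := fun _ => CategoryTheory.SingleObj.star M
      -- By `hΨ` the choice of the piece does not matter. Arrows in no piece are sent to 1, so the
      -- pieces need not cover all arrows.
      map := fun {x y} α => if h : ∃ i, x ∈ S i ∧ y ∈ S i then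
        (Ψ h.choose).map ((FreeGroupoid.of (Full (S h.choose))).map
          (show (⟨x, h.choose_spec.1⟩ : Full (S h.choose)) ⟶ ⟨y, h.choose_spec.2⟩ from α))
        else (1 : M) }
  refine ⟨FreeGroupoid.lift P, fun i => ?_⟩
  -- Once `Ψ i` is written as the lift of its values on arrows, it suffices to compare the two
  -- functors on arrows.
  rw [FreeGroupoid.lift_unique (FreeGroupoid.of _ ⋙q (Ψ i).toPrefunctor) (Ψ i) rfl]
  refine FreeGroupoid.lift_unique _ _ ?_
  refine Prefunctor.ext (fun _ => rfl) ?_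
  rintro ⟨x, hx⟩ ⟨y, hy⟩ α
  have h : ∃ i, x ∈ S i ∧ y ∈ S i := ⟨i, hx, hy⟩
  have h1 : (FreeGroupoid.lift P).map ((FreeGroupoid.of V).map (show x ⟶ y from α)) =
      P.map (show x ⟶ y from α) := Category.id_comp _
  refine Eq.trans (congrArg (FreeGroupoid.lift P).map
    (freeGroupoidFunctor_map_of (fullIncl (S i)) α)) ?_
  refine h1.trans ((dif_pos h).trans ?_)
  exact hΨ _ i x y α _ _ hx hy

end VanKampen

/-! ### Van Kampen for graphs: existence and uniqueness. -/

section Gluing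

variable {V : Type u} [Quiver.{v} V] {ι : Type*} {S : ι → Set V} {S₀ : Set V}
  {G : Type*} [Group G]

/-- Compatible homomorphisms from the vertex groups of a family of full subquivers, any two of which
meet in the connected subquiver on `S₀`, extend to a functor on the free groupoid of the
whole quiver. -/
theorem exists_functor_of_compatible (hS₀ : ∀ i, S₀ ⊆ S i)
    (hS : ∀ i j, i ≠ j → S i ∩ S j ⊆ S₀) (hconn : IsConnected (Full S₀)) {x₀ : V} (hx₀ : x₀ ∈ S₀)
    (φ : ∀ i, GraphPi1 (⟨x₀, hS₀ i hx₀⟩ : Full (S i)) →* G)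
    (hφ : ∀ i j (g : GraphPi1 (⟨x₀, hx₀⟩ : Full S₀)),
      φ i (graphPi1Map (fullInclOfSubset (hS₀ i)) ⟨x₀, hx₀⟩ g) =
        φ j (graphPi1Map (fullInclOfSubset (hS₀ j)) ⟨x₀, hx₀⟩ g)) :
    ∃ Φ : Quiver.FreeGroupoid V ⥤ SingleObj Gᵐᵒᵖ, ∀ i,
      (∀ g : GraphPi1 (⟨x₀, hS₀ i hx₀⟩ : Full (S i)),
        Φ.map ((freeGroupoidFunctor (fullIncl (S i))).map g) = op (φ i g)) ∧
      ∀ (x y : Quiver.FreeGroupoid (Full (S i))) (u v : x ⟶ y),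
        (∀ t : (Quiver.FreeGroupoid.of (Full (S i))).obj ⟨x₀, hS₀ i hx₀⟩ ⟶ x,
          φ i (t ≫ u ≫ inv v ≫ inv t) = 1) →
        Φ.map ((freeGroupoidFunctor (fullIncl (S i))).map u) =
          Φ.map ((freeGroupoidFunctor (fullIncl (S i))).map v) := by
  classical
  let τ : ∀ y : Full S₀, (Quiver.FreeGroupoid.of (Full S₀)).obj ⟨x₀, hx₀⟩ ⟶
      (Quiver.FreeGroupoid.of (Full S₀)).obj y :=
    fun y => walkClass (hconn.2 ⟨x₀, hx₀⟩ y).some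
  -- The walk chosen from `x₀` to itself may be a non-trivial loop; dividing by it makes the arrow
  -- at `x₀` the identity, so that the extension restricts to `φ i` on loops.
  let T₀ : ∀ y : Full S₀, (Quiver.FreeGroupoid.of (Full S₀)).obj ⟨x₀, hx₀⟩ ⟶
      (Quiver.FreeGroupoid.of (Full S₀)).obj y :=
    fun y => inv (τ ⟨x₀, hx₀⟩) ≫ τ y
  -- Over `S₀` the arrows for all `i` are images of the same arrow `T₀`; this is what makes the
  -- functors agree on the overlap.
  let T : ∀ (i : ι) (y : Quiver.FreeGroupoid (Full (S i))),
      Nonempty ((Quiver.FreeGroupoid.of (Full (S i))).obj ⟨x₀, hS₀ i hx₀⟩ ⟶ y) →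
      ((Quiver.FreeGroupoid.of (Full (S i))).obj ⟨x₀, hS₀ i hx₀⟩ ⟶ y) :=
    fun i y h => if hy : y.as.val ∈ S₀ then
      (freeGroupoidFunctor (fullInclOfSubset (hS₀ i))).map (T₀ ⟨y.as.val, hy⟩) else h.some
  have hT : ∀ i (y : Full S₀) h, T i ((Quiver.FreeGroupoid.of _).obj ⟨y.val, hS₀ i y.property⟩) h =
      (freeGroupoidFunctor (fullInclOfSubset (hS₀ i))).map (T₀ y) :=
    fun i y h => dif_pos y.property
  have hT1 : ∀ i h, T i ((Quiver.FreeGroupoid.of _).obj ⟨x₀, hS₀ i hx₀⟩) h = 𝟙 _ := by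
    intro i h
    refine (hT i ⟨x₀, hx₀⟩ h).trans ?_
    exact (congrArg (freeGroupoidFunctor (fullInclOfSubset (hS₀ i))).map
      (IsIso.inv_hom_id (τ ⟨x₀, hx₀⟩))).trans (CategoryTheory.Functor.map_id _ _)
  have key : ∀ i (x y : Full S₀)
      (f : (Quiver.FreeGroupoid.of _).obj x ⟶ (Quiver.FreeGroupoid.of _).obj y),
      (extendVertexHom (φ i) (T i)).map
        ((freeGroupoidFunctor (fullInclOfSubset (hS₀ i))).map f) =
      op (φ i (graphPi1Map (fullInclOfSubset (hS₀ i)) ⟨x₀, hx₀⟩ (T₀ x ≫ f ≫ inv (T₀ y)))) := by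
    intro i x y f
    let J := freeGroupoidFunctor (fullInclOfSubset (hS₀ i))
    rw [extendVertexHom_map (φ i) (T i) (J.map f) ⟨J.map (T₀ x)⟩ ⟨J.map (T₀ y)⟩]
    refine congrArg (fun a => op (φ i a)) ?_
    have h : J.map (T₀ x ≫ f ≫ inv (T₀ y)) = J.map (T₀ x) ≫ J.map f ≫ inv (J.map (T₀ y)) :=
      (J.map_comp _ _).trans (congrArg (J.map (T₀ x) ≫ ·)
        ((J.map_comp _ _).trans (congrArg (J.map f ≫ ·) (J.map_inv (T₀ y)))))
    refine Eq.trans ?_ h.symm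
    have hx := hT i x ⟨J.map (T₀ x)⟩
    have hy := hT i y ⟨J.map (T₀ y)⟩
    exact congrArg₂ (fun a b => a ≫ J.map f ≫ inv b) hx hy
  obtain ⟨Φ, hΦ⟩ := exists_functor_of_cover (fun i => extendVertexHom (φ i) (T i)) (by
    intro i j x y α hxi hyi hxj hyj
    by_cases hij : i = j
    · subst hij
      rfl
    -- A common arrow of two distinct pieces is an arrow of the full subquiver on `S₀`, where both
    -- functors are computed from one and the same loop.
    · let α₀ : (⟨x, hS i j hij ⟨hxi, hxj⟩⟩ : Full S₀) ⟶ ⟨y, hS i j hij ⟨hyi, hyj⟩⟩ := α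
      have hi := key i _ _ ((Quiver.FreeGroupoid.of _).map α₀)
      have hj := key j _ _ ((Quiver.FreeGroupoid.of _).map α₀)
      rw [freeGroupoidFunctor_map_of] at hi hj
      exact hi.trans ((congrArg op (hφ i j _)).trans hj.symm))
  have hΦmap : ∀ i {x y : Quiver.FreeGroupoid (Full (S i))} (u : x ⟶ y),
      Φ.map ((freeGroupoidFunctor (fullIncl (S i))).map u) =
        (extendVertexHom (φ i) (T i)).map u := by
    intro i x y u
    exact (Functor.congr_hom (hΦ i) u).trans ((Category.id_comp _).trans (Category.comp_id _))
  refine ⟨Φ, fun i => ⟨fun g => ?_, fun x y u v huv => ?_⟩⟩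
  · exact (hΦmap i g).trans (extendVertexHom_map_loop (φ i) (T i) (hT1 i) g)
  · exact (hΦmap i u).trans ((extendVertexHom_map_eq (φ i) (T i) u v huv).trans (hΦmap i v).symm)

/-- The map induced by the inclusion of a full subquiver on the arrows of the free groupoids. -/
def inclClass {S : Set V} {x y : Full S}
    (f : (Quiver.FreeGroupoid.of (Full S)).obj x ⟶ (Quiver.FreeGroupoid.of (Full S)).obj y) :
    (Quiver.FreeGroupoid.of V).obj x.val ⟶ (Quiver.FreeGroupoid.of V).obj y.val :=
  (freeGroupoidFunctor (fullIncl S)).map f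

theorem inclClass_id {S : Set V} (x : Full S) :
    inclClass (𝟙 ((Quiver.FreeGroupoid.of (Full S)).obj x)) = 𝟙 _ :=
  CategoryTheory.Functor.map_id _ _

theorem inclClass_comp {S : Set V} {x y z : Full S}
    (f : (Quiver.FreeGroupoid.of (Full S)).obj x ⟶ (Quiver.FreeGroupoid.of (Full S)).obj y)
    (g : (Quiver.FreeGroupoid.of (Full S)).obj y ⟶ (Quiver.FreeGroupoid.of (Full S)).obj z) :
    inclClass (f ≫ g) = inclClass f ≫ inclClass g :=
  Functor.map_comp _ _ _

theorem inclClass_inv {S : Set V} {x y : Full S}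
    (f : (Quiver.FreeGroupoid.of (Full S)).obj x ⟶ (Quiver.FreeGroupoid.of (Full S)).obj y) :
    inclClass (inv f) = inv (inclClass f) :=
  Functor.map_inv (freeGroupoidFunctor (fullIncl S)) f

/-- If every arrow lies in one of the full subquivers on the sets `S i`, any two of which meet in
the connected subquiver on `S₀`, then the fundamental group of the graph is generated by the
images of the fundamental groups of these subquivers. -/
theorem graphPi1_hom_ext [Nonempty ι] (hS₀ : ∀ i, S₀ ⊆ S i)
    (hS : ∀ i j, i ≠ j → S i ∩ S j ⊆ S₀) (hconn : IsConnected (Full S₀))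
    (harr : ∀ (x y : V) (_ : x ⟶ y), ∃ i, x ∈ S i ∧ y ∈ S i) {x₀ : V} (hx₀ : x₀ ∈ S₀)
    {a b : GraphPi1 x₀ →* G}
    (hab : ∀ i (g : GraphPi1 (⟨x₀, hS₀ i hx₀⟩ : Full (S i))),
      a (graphPi1Map (fullIncl (S i)) ⟨x₀, hS₀ i hx₀⟩ g) =
        b (graphPi1Map (fullIncl (S i)) ⟨x₀, hS₀ i hx₀⟩ g)) : a = b := by
  -- The walks to `t` are closed up inside a single piece. Asking this for every piece containing
  -- `t` lets the next arrow of the walk lie in any of them.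
  let Good : ∀ t : V, ((Quiver.FreeGroupoid.of V).obj x₀ ⟶
      (Quiver.FreeGroupoid.of V).obj t) → Prop :=
    fun t f => ∀ i (ht : t ∈ S i),
      ∃ τ : (Quiver.FreeGroupoid.of (Full (S i))).obj ⟨x₀, hS₀ i hx₀⟩ ⟶
        (Quiver.FreeGroupoid.of (Full (S i))).obj ⟨t, ht⟩,
      a (f ≫ inv (inclClass τ)) = b (f ≫ inv (inclClass τ))
  have step : ∀ j (t t' : Full (S j))
      (f : (Quiver.FreeGroupoid.of V).obj x₀ ⟶ (Quiver.FreeGroupoid.of V).obj t.val)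
      (e : (Quiver.FreeGroupoid.of (Full (S j))).obj t ⟶
        (Quiver.FreeGroupoid.of (Full (S j))).obj t'),
      Good t.val f → Good t'.val (f ≫ inclClass e) := by
    intro j t t' f e hf i ht'
    obtain ⟨τ, hτ⟩ := hf j t.property
    by_cases hij : i = j
    · subst hij
      refine ⟨τ ≫ e, ?_⟩
      have : (f ≫ inclClass e) ≫ inv (inclClass (τ ≫ e)) = f ≫ inv (inclClass τ) := by
        rw [inclClass_comp, IsIso.inv_comp, Category.assoc, IsIso.hom_inv_id_assoc]
      exact (congrArg a this).trans (hτ.trans (congrArg b this).symm)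
    -- Change of piece: `t'` lies in `S₀`, so the return path can be taken there. The new loop is
    -- the old one times a loop in the piece `j`, on which `a` and `b` agree.
    · let t₀ : Full S₀ := ⟨t'.val, hS i j hij ⟨ht', t'.property⟩⟩
      let ρ : (Quiver.FreeGroupoid.of (Full S₀)).obj ⟨x₀, hx₀⟩ ⟶
          (Quiver.FreeGroupoid.of (Full S₀)).obj t₀ :=
        walkClass (hconn.2 ⟨x₀, hx₀⟩ t₀).some
      let ρ' : ∀ i, (Quiver.FreeGroupoid.of (Full (S i))).obj ⟨x₀, hS₀ i hx₀⟩ ⟶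
          (Quiver.FreeGroupoid.of (Full (S i))).obj ⟨t'.val, hS₀ i t₀.property⟩ :=
        fun i => (freeGroupoidFunctor (fullInclOfSubset (hS₀ i))).map ρ
      have hρ : inclClass (S := S i) (ρ' i) = inclClass (S := S j) (ρ' j) :=
        (freeGroupoidFunctor_map_map (fullInclOfSubset (hS₀ i)) (fullIncl (S i)) ρ).trans
          (freeGroupoidFunctor_map_map (fullInclOfSubset (hS₀ j)) (fullIncl (S j)) ρ).symm
      refine ⟨ρ' i, ?_⟩
      have h : (f ≫ inclClass e) ≫ inv (inclClass (S := S i) (ρ' i)) =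
          (f ≫ inv (inclClass τ)) ≫ inclClass (τ ≫ e ≫ inv (ρ' j)) := by
        refine (congrArg (fun z => (f ≫ inclClass e) ≫ inv z) hρ).trans ?_
        rw [inclClass_comp, inclClass_comp, inclClass_inv, Category.assoc, Category.assoc,
          IsIso.inv_hom_id_assoc]
      refine (congrArg a h).trans (Eq.trans ?_ (congrArg b h).symm)
      refine (map_mul a _ _).trans (Eq.trans ?_ (map_mul b _ _).symm)
      exact congrArg₂ (· * ·) hτ (hab j _)
  have good : ∀ (t : Symmetrify V) (p : @Path (Symmetrify V) _ x₀ t),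
      Good t (walkClass (x := x₀) (y := t) p) := by
    intro t p
    induction p with
    | nil =>
      intro i ht
      refine ⟨𝟙 _, ?_⟩
      have : 𝟙 _ ≫ inv (inclClass (𝟙 ((Quiver.FreeGroupoid.of (Full (S i))).obj ⟨x₀, hS₀ i hx₀⟩))) =
          𝟙 _ := by
        rw [inclClass_id, IsIso.inv_id, Category.comp_id]
      exact (congrArg a this).trans
        ((map_one a).trans ((map_one b).symm.trans (congrArg b this).symm))
    | @cons t t' p e ih =>
      rcases e with α | α
      · obtain ⟨j, ht, ht'⟩ := harr _ _ α
        let α' : (⟨t, ht⟩ : Full (S j)) ⟶ ⟨t', ht'⟩ := α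
        have h := step j ⟨t, ht⟩ ⟨t', ht'⟩ _ ((Quiver.FreeGroupoid.of (Full (S j))).map α') ih
        have e : inclClass ((Quiver.FreeGroupoid.of (Full (S j))).map α') =
            (Quiver.FreeGroupoid.of V).map α :=
          freeGroupoidFunctor_map_of (fullIncl (S j)) _
        rw [e] at h
        exact h
      · obtain ⟨j, ht', ht⟩ := harr _ _ α
        let α' : (⟨t', ht'⟩ : Full (S j)) ⟶ ⟨t, ht⟩ := α
        have h := step j ⟨t, ht⟩ ⟨t', ht'⟩ _
          (Groupoid.inv ((Quiver.FreeGroupoid.of (Full (S j))).map α')) ih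
        have e : inclClass (Groupoid.inv ((Quiver.FreeGroupoid.of (Full (S j))).map α')) =
            Groupoid.inv ((Quiver.FreeGroupoid.of V).map α) :=
          (functor_map_inv _ _).trans (congrArg Groupoid.inv
            (freeGroupoidFunctor_map_of (fullIncl (S j)) _))
        rw [e] at h
        exact h
  ext g
  obtain ⟨p, rfl⟩ := walkClass_surjective x₀ x₀ g
  let i : ι := Classical.arbitrary ι
  -- At the end of the walk `τ` is itself a loop at `x₀` in the piece `i`, so it can be removed.
  obtain ⟨τ, hτ⟩ := good x₀ p i (hS₀ i hx₀)
  have h : walkClass p = (walkClass p ≫ inv (inclClass τ)) ≫ inclClass τ := by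
    rw [Category.assoc, IsIso.inv_hom_id, Category.comp_id]
  refine (congrArg a h).trans (Eq.trans ?_ (congrArg b h).symm)
  refine (map_mul a _ _).trans (Eq.trans ?_ (map_mul b _ _).symm)
  exact congrArg₂ (· * ·) hτ (hab i τ)

end Gluing

/-! ### Passing from graphs to bound quivers. -/

section Quotients

variable {k : Type w} [Field k] {V : Type u} [Quiver.{v} V] [Finite V]
  {I : TwoSidedIdeal (PathAlgebra k V)} {G : Type*} [Group G]

/-- A functor on the free groupoid that identifies the paths appearing in one minimal relation
identifies homotopic walks. -/
theorem Homotopic.functor_map_eq {D : Type*} [Groupoid D] (Φ : Quiver.FreeGroupoid V ⥤ D)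
    (hΦ : ∀ (x y : V) (r : Path x y →₀ k), IsMinimalRelation I r → ∀ p ∈ r.support,
      ∀ q ∈ r.support, Φ.map (walkClass (toWalk p)) = Φ.map (walkClass (toWalk q)))
    {x y : V} {p q : Walk x y} (h : Homotopic I p q) :
    Φ.map (walkClass p) = Φ.map (walkClass q) := by
  induction h with
  | refl p => rfl
  | symm _ ih => exact ih.symm
  | trans _ _ ih₁ ih₂ => exact ih₁.trans ih₂
  | cancel_right α =>
    refine congrArg Φ.map ?_
    refine Eq.trans ?_ (Groupoid.comp_inv ((Quiver.FreeGroupoid.of V).map α))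
    exact congrArg (· ≫ Groupoid.inv ((Quiver.FreeGroupoid.of V).map α)) (Category.id_comp _)
  | cancel_left α =>
    refine congrArg Φ.map ?_
    refine Eq.trans ?_ (Groupoid.inv_comp ((Quiver.FreeGroupoid.of V).map α))
    exact congrArg (· ≫ (Quiver.FreeGroupoid.of V).map α) (Category.id_comp _)
  | minimal r hr p q hp hq => exact hΦ _ _ r hr p hp q hq
  | comp l l' _ ih =>
    rw [walkClass_comp, walkClass_comp, walkClass_comp, walkClass_comp, Functor.map_comp,
      Functor.map_comp, Functor.map_comp, Functor.map_comp, ih]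

/-- The homomorphism on the vertex group at `x₀` given by a functor to a group. -/
def vertexHom (Φ : Quiver.FreeGroupoid V ⥤ SingleObj Gᵐᵒᵖ) (x₀ : V) : GraphPi1 x₀ →* G where
  toFun g := unop (show Gᵐᵒᵖ from Φ.map g)
  map_one' := congrArg unop (Φ.map_id ((Quiver.FreeGroupoid.of V).obj x₀))
  map_mul' f g := congrArg unop (Φ.map_comp f g)

/-- A functor on the whole groupoid is needed, since the homotopic paths in a generator need not
start at `x₀`. It gives them equal values, and the generator collapses. -/
theorem homotopySubgroup_le_ker_vertexHom (Φ : Quiver.FreeGroupoid V ⥤ SingleObj Gᵐᵒᵖ)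
    (hΦ : ∀ (x y : V) (r : Path x y →₀ k), IsMinimalRelation I r → ∀ p ∈ r.support,
      ∀ q ∈ r.support, Φ.map (walkClass (toWalk p)) = Φ.map (walkClass (toWalk q))) (x₀ : V) :
    homotopySubgroup I x₀ ≤ (vertexHom Φ x₀).ker := by
  refine Subgroup.normalClosure_le_normal ?_
  rintro _ ⟨x, y, l, p, q, hpq, rfl⟩
  refine congrArg unop (?_ : Φ.map _ = 𝟙 _)
  rw [Functor.map_comp, Functor.map_comp, Functor.map_comp, hpq.functor_map_eq Φ hΦ,
    functor_map_inv, functor_map_inv, Groupoid.inv_eq_inv, Groupoid.inv_eq_inv,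
    IsIso.hom_inv_id_assoc, IsIso.hom_inv_id]

/-- The generators of the subgroup are conjugated by walks; `walkClass_surjective` allows any arrow
of the groupoid instead. -/
theorem mk_loop_eq_one {x₀ x y : V} {u v : Path x y} (h : Homotopic I (toWalk u) (toWalk v))
    (t : (Quiver.FreeGroupoid.of V).obj x₀ ⟶ (Quiver.FreeGroupoid.of V).obj x) :
    QuotientGroup.mk' (homotopySubgroup I x₀)
      (t ≫ walkClass (toWalk u) ≫ inv (walkClass (toWalk v)) ≫ inv t) = 1 := by
  obtain ⟨l, rfl⟩ := walkClass_surjective _ _ t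
  refine (QuotientGroup.eq_one_iff _).2 (Subgroup.subset_normalClosure ⟨x, y, l, u, v, h, ?_⟩)
  rw [Groupoid.inv_eq_inv, Groupoid.inv_eq_inv]

end Quotients

/-! ### The universal property. -/

section Pushout

variable {k : Type w} [Field k] {V : Type u} [Quiver.{v} V] [Finite V]
  {I : TwoSidedIdeal (PathAlgebra k V)} {ι : Type*} {S : ι → Set V} {S₀ : Set V}
  {G : Type*} [Group G]

theorem pi1_hom_ext {x₀ : V} {a b : Pi1 I x₀ →* G}
    (h : a.comp (QuotientGroup.mk' (homotopySubgroup I x₀)) =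
      b.comp (QuotientGroup.mk' (homotopySubgroup I x₀))) : a = b :=
  QuotientGroup.monoidHom_ext (N := homotopySubgroup I x₀) h

/-- Both composites in the square thus equal the map induced by $Q^0\subseteq Q$, which gives
commutativity. -/
theorem pi1Incl_pi1InclOfSubset (I : TwoSidedIdeal (PathAlgebra k V)) {S T : Set V} (h : S ⊆ T)
    (x₀ : Full S) :
    (pi1Incl I T ⟨x₀.val, h x₀.property⟩).comp (pi1InclOfSubset I h x₀) = pi1Incl I S x₀ := by
  refine pi1_hom_ext (MonoidHom.ext fun g => ?_)
  exact congrArg (QuotientGroup.mk' (homotopySubgroup I x₀.val))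
    (freeGroupoidFunctor_map_map (fullInclOfSubset h) (fullIncl T) g)

theorem pi1_hom_ext_of_cover [Nonempty ι] (hS₀ : ∀ i, S₀ ⊆ S i)
    (hS : ∀ i j, i ≠ j → S i ∩ S j ⊆ S₀) (hconn : IsConnected (Full S₀))
    (harr : ∀ (x y : V) (_ : x ⟶ y), ∃ i, x ∈ S i ∧ y ∈ S i) {x₀ : V} (hx₀ : x₀ ∈ S₀)
    {a b : Pi1 I x₀ →* G}
    (hab : ∀ i, a.comp (pi1Incl I (S i) ⟨x₀, hS₀ i hx₀⟩) =
      b.comp (pi1Incl I (S i) ⟨x₀, hS₀ i hx₀⟩)) : a = b :=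
  pi1_hom_ext (graphPi1_hom_ext hS₀ hS hconn harr hx₀ fun i g =>
    DFunLike.congr_fun (hab i) (QuotientGroup.mk' (homotopySubgroup (restrict I (S i)) _) g))

theorem exists_pi1_hom (hS₀ : ∀ i, S₀ ⊆ S i) (hS : ∀ i j, i ≠ j → S i ∩ S j ⊆ S₀)
    (hconv : ∀ i, IsConvex (S i)) (hconn : IsConnected (Full S₀))
    (hcover : ∀ (x y : V) (p : Path x y), IsNonzeroPath I p → ∃ i, LiesIn p (S i))
    {x₀ : V} (hx₀ : x₀ ∈ S₀)
    (f : ∀ i, Pi1 (restrict I (S i)) (⟨x₀, hS₀ i hx₀⟩ : Full (S i)) →* G)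
    (hf : ∀ i j, (f i).comp (pi1InclOfSubset I (hS₀ i) ⟨x₀, hx₀⟩) =
      (f j).comp (pi1InclOfSubset I (hS₀ j) ⟨x₀, hx₀⟩)) :
    ∃ F : Pi1 I x₀ →* G, ∀ i, F.comp (pi1Incl I (S i) ⟨x₀, hS₀ i hx₀⟩) = f i := by
  obtain ⟨Φ, hΦ⟩ := exists_functor_of_compatible hS₀ hS hconn hx₀
    (fun i => (f i).comp (QuotientGroup.mk' (homotopySubgroup (restrict I (S i)) _)))
    (fun i j g => DFunLike.congr_fun (hf i j)
      (QuotientGroup.mk' (homotopySubgroup (restrict I S₀) _) g))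
  have hrel : ∀ (x y : V) (r : Path x y →₀ k), IsMinimalRelation I r → ∀ p ∈ r.support,
      ∀ q ∈ r.support, Φ.map (walkClass (toWalk p)) = Φ.map (walkClass (toWalk q)) := by
    intro x y r hr p hp q hq
    obtain ⟨i, hi⟩ := hcover x y p (hr.isNonzeroPath hp)
    have hx : x ∈ S i := hi x (Path.start_mem_vertices p)
    have hy : y ∈ S i := hi y (Path.end_mem_vertices p)
    -- The cover places only `p` in the piece `i`; convexity brings `q` and the whole relation
    -- along.
    obtain ⟨r', hr', hlift⟩ := hr.exists_restrict (hconv i) hx hy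
    obtain ⟨p', hp', rfl⟩ := hlift p hp
    obtain ⟨q', hq', rfl⟩ := hlift q hq
    have h := (hΦ i).2 _ _ (walkClass (toWalk p')) (walkClass (toWalk q')) (fun t =>
      (congrArg (f i) (mk_loop_eq_one (.minimal r' hr' p' q' hp' hq') t)).trans (map_one (f i)))
    rw [freeGroupoidFunctor_walkClass, freeGroupoidFunctor_walkClass, mapWalk_toWalk,
      mapWalk_toWalk] at h
    exact h
  refine ⟨QuotientGroup.lift (homotopySubgroup I x₀) (vertexHom Φ x₀)
    (homotopySubgroup_le_ker_vertexHom Φ hrel x₀), fun i => ?_⟩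
  refine pi1_hom_ext (MonoidHom.ext fun g => ?_)
  exact congrArg unop ((hΦ i).1 g)

end Pushout

end BoundQuiver

theorem corollary3p5 {k : Type*} [Field k] {V : Type*} [Quiver V]
    [Finite V] [∀ x y : V, Finite (x ⟶ y)]
    (I : TwoSidedIdeal (BoundQuiver.PathAlgebra k V)) (hI : BoundQuiver.IsAdmissible I)
    (S₁ S₂ : Set V) (hS₁ : BoundQuiver.IsConvex S₁) (hS₂ : BoundQuiver.IsConvex S₂)
    (hcover : ∀ (x y : V) (p : Quiver.Path x y), BoundQuiver.IsNonzeroPath I p →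
      BoundQuiver.LiesIn p S₁ ∨ BoundQuiver.LiesIn p S₂)
    (hconn : BoundQuiver.IsConnected (BoundQuiver.Full (S₁ ∩ S₂)))
    (x₀ : V) (hx₁ : x₀ ∈ S₁) (hx₂ : x₀ ∈ S₂) :
    CategoryTheory.IsPushout
      (GrpCat.ofHom (BoundQuiver.pi1InclOfSubset I
        (Set.inter_subset_left : S₁ ∩ S₂ ⊆ S₁) ⟨x₀, hx₁, hx₂⟩))
      (GrpCat.ofHom (BoundQuiver.pi1InclOfSubset I
        (Set.inter_subset_right : S₁ ∩ S₂ ⊆ S₂) ⟨x₀, hx₁, hx₂⟩))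
      (GrpCat.ofHom (BoundQuiver.pi1Incl I S₁ ⟨x₀, hx₁⟩))
      (GrpCat.ofHom (BoundQuiver.pi1Incl I S₂ ⟨x₀, hx₂⟩)) := by
  -- The index `true` stands for `S₁` and `false` for `S₂`; `Bool.rec` takes the value at `false`
  -- first.
  let S : Bool → Set V := fun b => Bool.rec S₂ S₁ b
  have hS₀ : ∀ b, S₁ ∩ S₂ ⊆ S b := by
    rintro (_ | _)
    exacts [Set.inter_subset_right, Set.inter_subset_left]
  have hS : ∀ i j, i ≠ j → S i ∩ S j ⊆ S₁ ∩ S₂ := by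
    rintro (_ | _) (_ | _) h
    exacts [absurd rfl h, (Set.inter_comm S₂ S₁).subset, subset_rfl, absurd rfl h]
  have hconv : ∀ i, BoundQuiver.IsConvex (S i) := by
    rintro (_ | _)
    exacts [hS₂, hS₁]
  have hcov : ∀ (x y : V) (p : Quiver.Path x y), BoundQuiver.IsNonzeroPath I p →
      ∃ i, BoundQuiver.LiesIn p (S i) := fun x y p hp =>
    (hcover x y p hp).elim (fun h => ⟨true, h⟩) fun h => ⟨false, h⟩
  -- Admissibility is used here, and only uniqueness depends on it.
  have harr : ∀ (x y : V) (_ : x ⟶ y), ∃ i, x ∈ S i ∧ y ∈ S i := by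
    intro x y α
    obtain ⟨i, hi⟩ := hcov x y α.toPath (hI.isNonzeroPath _ (by simp))
    exact ⟨i, hi x (Quiver.Path.start_mem_vertices _), hi y (Quiver.Path.end_mem_vertices _)⟩
  have hw := (BoundQuiver.pi1Incl_pi1InclOfSubset I Set.inter_subset_left ⟨x₀, hx₁, hx₂⟩).trans
    (BoundQuiver.pi1Incl_pi1InclOfSubset I Set.inter_subset_right ⟨x₀, hx₁, hx₂⟩).symm
  refine ⟨⟨GrpCat.hom_ext hw⟩, ⟨CategoryTheory.Limits.PushoutCocone.isColimitAux' _ fun s => ?_⟩⟩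
  have hs := congrArg GrpCat.Hom.hom s.condition
  have hF := BoundQuiver.exists_pi1_hom (S := S) hS₀ hS hconv hconn hcov ⟨hx₁, hx₂⟩
    (fun b => Bool.rec s.inr.hom s.inl.hom b) (by
      rintro (_ | _) (_ | _)
      exacts [rfl, hs.symm, hs, rfl])
  refine ⟨GrpCat.ofHom hF.choose, GrpCat.hom_ext (hF.choose_spec true),
    GrpCat.hom_ext (hF.choose_spec false), fun {m} h₁ h₂ => GrpCat.hom_ext ?_⟩
  refine BoundQuiver.pi1_hom_ext_of_cover (S := S) hS₀ hS hconn harr ⟨hx₁, hx₂⟩ ?_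
  rintro (_ | _)
  · exact (congrArg GrpCat.Hom.hom h₂).trans (hF.choose_spec false).symm
  · exact (congrArg GrpCat.Hom.hom h₁).trans (hF.choose_spec true).symm
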